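/- All graphs are finite, undirected and simple. A vertex set $D$ of a graph $G=(V,E)$ is an efficient dominating set (e.d.) if for every vertex $v\in V$ there is exactly one $d\in D$ with $d=v$ or $dv\in E$. The problem Weighted Efficient Domination (WED) is: given a graph $G=(V,E)$ and a weight function $\omega:V\to\mathbb{N}$, find an e.d. $D$ of $G$ of minimum total weight $\sum_{v\in D}\omega(v)$, or report that $G$ has no e.d. Let $P_5+kP_2$ denote the disjoint union of a chordless path on five vertices and $k$ chordless paths on two vertices; a graph is $(P_5+kP_2)$-free if none of its induced subgraphs is isomorphic to $P_5+kP_2$. For every fixed integer $k\ge 0$, WED is solvable in polynomial time for $(P_5+kP_2)$-free graphs. That is, there are a program of a random access machine (each assignment, test, memory access, addition and truncated subtraction of natural numbers counts as one step) and a polynomial $p$, both depending only on $k$, such that on every input consisting of a $(P_5+kP_2)$-free graph on $n$ vertices, given by its adjacency matrix, and arbitrary vertex weights, stored one per memory cell, the program halts after at most $p(n)$ steps with a correct answer: an e.d. of minimum weight if $G$ has an e.d., and the report that there is none otherwise. -/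

import Mathlib

namespace WED

/-! ### Graphs -/

/-- `kH`: the disjoint union of `k` copies of the graph `H`. -/
def copies (k : ℕ) {V : Type*} (H : SimpleGraph V) : SimpleGraph (Fin k × V) where
  Adj x y := x.1 = y.1 ∧ H.Adj x.2 y.2
  symm := ⟨fun _ _ h => ⟨h.1.symm, h.2.symm⟩⟩
  loopless := ⟨fun _ h => H.irrefl h.2⟩

/-- The graph `P_5 + k P_2`, the disjoint union of a path on five vertices and `k` paths on two
vertices. -/
def P5kP2 (k : ℕ) : SimpleGraph (Fin 5 ⊕ Fin k × Fin 2) :=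
  SimpleGraph.sum (SimpleGraph.pathGraph 5) (copies k (SimpleGraph.pathGraph 2))

/-- `G` is `F`-free: no induced subgraph of `G` is isomorphic to `F`. -/
def IndFree {U V : Type*} (F : SimpleGraph U) (G : SimpleGraph V) : Prop :=
  ¬ F.IsIndContained G

/-- `D` is an efficient dominating set of `G`: every vertex is dominated by (equal to or adjacent
to) exactly one vertex of `D`. -/
def IsEffDom {V : Type*} (G : SimpleGraph V) (D : Finset V) : Prop :=
  ∀ v : V, ∃! d : V, d ∈ D ∧ (d = v ∨ G.Adj d v)

/-- `D` is an efficient dominating set of `G` of minimum total weight. -/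
def IsMinEffDom {V : Type*} (G : SimpleGraph V) (w : V → ℕ) (D : Finset V) : Prop :=
  IsEffDom G D ∧ ∀ D' : Finset V, IsEffDom G D' → ∑ v ∈ D, w v ≤ ∑ v ∈ D', w v

/-! ### Random access machine programs with a step count

The cells hold natural numbers, and the only arithmetic operations are addition and truncated
subtraction, so that counting one step per operation is polynomially equivalent to the running
time of a Turing machine. -/

/-- The store of a random access machine: registers `reg x`, and arrays `arr a` with cells
`arr a i`. A program names registers and arrays by constants; cells are addressed by computed
indices. -/
@[ext]
structure Store where
  reg : ℕ → ℕ
  arr : ℕ → ℕ → ℕ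

/-- Arithmetic expressions. -/
inductive Expr where
  | const (c : ℕ)
  | reg (x : ℕ)
  | cell (a : ℕ) (i : Expr)
  | add (e f : Expr)
  | sub (e f : Expr)

/-- The value of an expression. -/
def Expr.eval (s : Store) : Expr → ℕ
  | .const c => c
  | .reg x => s.reg x
  | .cell a i => s.arr a (i.eval s)
  | .add e f => e.eval s + f.eval s
  | .sub e f => e.eval s - f.eval s

/-- The number of elementary operations performed to evaluate an expression. -/
def Expr.cost : Expr → ℕ
  | .const _ => 1
  | .reg _ => 1
  | .cell _ i => i.cost + 1
  | .add e f => e.cost + f.cost + 1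
  | .sub e f => e.cost + f.cost + 1

/-- Programs. -/
inductive Prog where
  | skip
  /-- `x := e` -/
  | assign (x : ℕ) (e : Expr)
  /-- `a[i] := e` -/
  | write (a : ℕ) (i e : Expr)
  | seq (p q : Prog)
  /-- run `p` if `e` is nonzero, and `q` otherwise -/
  | cond (e : Expr) (p q : Prog)
  /-- repeat `p` as long as `e` is nonzero -/
  | loop (e : Expr) (p : Prog)

/-- `Exec p s t s'`: started in the store `s`, the program `p` halts after exactly `t` steps in
the store `s'`. -/
inductive Exec : Prog → Store → ℕ → Store → Prop where
  | skip (s : Store) : Exec .skip s 1 s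
  | assign (x : ℕ) (e : Expr) (s : Store) :
      Exec (.assign x e) s (e.cost + 1) ⟨Function.update s.reg x (e.eval s), s.arr⟩
  | write (a : ℕ) (i e : Expr) (s : Store) :
      Exec (.write a i e) s (i.cost + e.cost + 1)
        ⟨s.reg, Function.update s.arr a (Function.update (s.arr a) (i.eval s) (e.eval s))⟩
  | seq {p q : Prog} {s s' s'' : Store} {t t' : ℕ} :
      Exec p s t s' → Exec q s' t' s'' → Exec (.seq p q) s (t + t') s''
  | cond_true {e : Expr} {p q : Prog} {s s' : Store} {t : ℕ} :
      e.eval s ≠ 0 → Exec p s t s' → Exec (.cond e p q) s (e.cost + 1 + t) s'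
  | cond_false {e : Expr} {p q : Prog} {s s' : Store} {t : ℕ} :
      e.eval s = 0 → Exec q s t s' → Exec (.cond e p q) s (e.cost + 1 + t) s'
  | loop_done {e : Expr} {p : Prog} {s : Store} :
      e.eval s = 0 → Exec (.loop e p) s (e.cost + 1) s
  | loop_step {e : Expr} {p : Prog} {s s' s'' : Store} {t t' : ℕ} :
      e.eval s ≠ 0 → Exec p s t s' → Exec (.loop e p) s' t' s'' →
        Exec (.loop e p) s (e.cost + 1 + t + t') s''

/-! ### The problem WED -/

open Classical in
/-- The initial store for a graph `G` on the vertices `0, …, n - 1` with weights `w`: register `0`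
holds `n`, array `0` holds the adjacency matrix (row by row), array `1` holds the weights, and
everything else is `0`. -/
noncomputable def inputStore {n : ℕ} (G : SimpleGraph (Fin n)) (w : Fin n → ℕ) : Store where
  reg x := if x = 0 then n else 0
  arr a i :=
    if a = 0 then
      if ∃ u v : Fin n, G.Adj u v ∧ i = (u : ℕ) * n + (v : ℕ) then 1 else 0
    else if a = 1 then
      if h : i < n then w ⟨i, h⟩ else 0
    else 0

/-- The vertex set whose indicator function is stored in array `2`. -/
def outputSet (n : ℕ) (s : Store) : Finset (Fin n) :=
  Finset.univ.filter fun v => s.arr 2 (v : ℕ) ≠ 0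

/-- The final store `s` answers the instance `(G, w)` of WED: either register `0` is nonzero and
array `2` holds an efficient dominating set of minimum weight, or register `0` is zero and `G` has
no efficient dominating set. -/
def IsAnswer {n : ℕ} (G : SimpleGraph (Fin n)) (w : Fin n → ℕ) (s : Store) : Prop :=
  (s.reg 0 ≠ 0 ∧ IsMinEffDom G w (outputSet n s)) ∨
    (s.reg 0 = 0 ∧ ¬ ∃ D : Finset (Fin n), IsEffDom G D)

/-- WED is solvable in polynomial time on the graph class `C`: a single program answers every
instance whose graph has `n` vertices and belongs to `C`, with any weights, within a number of
steps that is bounded by a polynomial in `n`. -/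
def SolvableInPolyTime (C : ∀ n : ℕ, SimpleGraph (Fin n) → Prop) : Prop :=
  ∃ (p : Prog) (b : Polynomial ℕ), ∀ (n : ℕ) (G : SimpleGraph (Fin n)) (w : Fin n → ℕ), C n G →
    ∃ (t : ℕ) (s : Store), Exec p (inputStore G w) t s ∧ t ≤ b.eval n ∧ IsAnswer G w s

end WED

/-!
Let `D` be an efficient dominating set of the `(P_5 + kP_2)`-free graph `G`.

If `G` contains an induced `P_5`, choose `j < k` such that `G` has an induced subgraph `H`
isomorphic to `P_5 + jP_2` but is `(P_5 + (j+1)P_2)`-free. Then the vertices outside `N[H]` are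
pairwise nonadjacent. Let `S` consist of the at most `5 + 2j` vertices of `D` that dominate `H`. A
vertex of `D` outside `S` has distance at least three from `S`, and a vertex at distance at least
three from `S` must belong to `D`, since it and its dominator both lie outside `N[H]` and are
therefore equal, being nonadjacent. So `D` is determined by `S` (`exists_extension`), and it
suffices to try all tuples of `5 + 2k` vertices (`isMinEffDom_bestExtension`).

If `G` contains no induced `P_5`, its components have diameter at most three. Let `v ∈ D`. A
component `Q` of the graph induced by the vertices at distance three from `v` is seen from outside
either completely or not at all by every vertex (`Remote.adj_of_adj`), so `D` meets `Q` in exactly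
one vertex, which is adjacent to all of `Q`; any other vertex adjacent to all of `Q` has the same
closed neighbourhood and can replace it (`IsEffDom.near1_iff_of_universal`). So the cheapest
efficient dominating set of the component of `v` that contains `v` consists of `v` and the cheapest
such vertex of each `Q`, and it remains to choose the best `v` in each component of `G`
(`isMinEffDom_selectedUnion`).

Membership in both candidates is a property of a vertex that can be written with adjacency, order
and equality of vertices, quantifiers over vertices or over tuples of fixed length, and comparison
of sums of weights. Every such property is decided by a program in polynomial time (`Computes`,
`Decides`): a quantifier is a sum, and a sum over all vertices is a loop. It remains to
test whether the candidate is an efficient dominating set (`solvableInPolyTime_of_decides`).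
-/

namespace WED

/-! ### Running programs within a time bound -/

/-- Started in `s`, the program `p` halts after at most `T` steps in a store satisfying `Q`. -/
def Runs (p : Prog) (s : Store) (T : ℕ) (Q : Store → Prop) : Prop :=
  ∃ t s', Exec p s t s' ∧ t ≤ T ∧ Q s'

theorem Runs.mono {p : Prog} {s : Store} {T T' : ℕ} {Q Q' : Store → Prop} (h : Runs p s T Q)
    (hT : T ≤ T') (hQ : ∀ s', Q s' → Q' s') : Runs p s T' Q' := by
  obtain ⟨t, s', he, ht, hq⟩ := h
  exact ⟨t, s', he, ht.trans hT, hQ _ hq⟩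

theorem Runs.seq {p q : Prog} {s : Store} {T T' : ℕ} {Q Q' : Store → Prop} (hp : Runs p s T Q)
    (hq : ∀ s', Q s' → Runs q s' T' Q') : Runs (p.seq q) s (T + T') Q' := by
  obtain ⟨t, s', he, ht, h⟩ := hp
  obtain ⟨t', s'', he', ht', h'⟩ := hq s' h
  exact ⟨t + t', s'', .seq he he', by omega, h'⟩

theorem Runs.assign {x : ℕ} {e : Expr} {s : Store} {Q : Store → Prop}
    (h : ∀ s' : Store, s'.arr = s.arr → s'.reg x = e.eval s → (∀ r ≠ x, s'.reg r = s.reg r) →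
      Q s') : Runs (.assign x e) s (e.cost + 1) Q :=
  ⟨_, _, .assign x e s, le_rfl, h _ rfl (Function.update_self ..)
    fun _ hr => Function.update_of_ne hr ..⟩

theorem Runs.write {a : ℕ} {i e : Expr} {s : Store} {Q : Store → Prop}
    (h : ∀ s' : Store, s'.reg = s.reg →
      s'.arr a = Function.update (s.arr a) (i.eval s) (e.eval s) →
      (∀ b ≠ a, s'.arr b = s.arr b) → Q s') :
    Runs (.write a i e) s (i.cost + e.cost + 1) Q :=
  ⟨_, _, .write a i e s, le_rfl, h _ rfl (Function.update_self ..)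
    fun _ hb => Function.update_of_ne hb ..⟩

theorem Runs.cond {e : Expr} {p q : Prog} {s : Store} {T T' : ℕ} {Q : Store → Prop}
    (hp : e.eval s ≠ 0 → Runs p s T Q) (hq : e.eval s = 0 → Runs q s T' Q) :
    Runs (.cond e p q) s (e.cost + 1 + (T + T')) Q := by
  by_cases h : e.eval s = 0
  · obtain ⟨t, s', he, ht, hQ⟩ := hq h
    exact ⟨_, s', .cond_false h he, by omega, hQ⟩
  · obtain ⟨t, s', he, ht, hQ⟩ := hp h
    exact ⟨_, s', .cond_true h he, by omega, hQ⟩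

/-- A loop whose invariant `Inv i` holds before iteration `i` and whose test fails exactly when
`N` iterations have been made. -/
theorem Runs.loop {e : Expr} {p : Prog} {N T : ℕ} (Inv : ℕ → Store → Prop)
    (step : ∀ i s, i < N → Inv i s → e.eval s ≠ 0 ∧ Runs p s T (Inv (i + 1)))
    (halt : ∀ s, Inv N s → e.eval s = 0) {s : Store} (h : Inv 0 s) :
    Runs (.loop e p) s ((N + 1) * (e.cost + 1 + T)) (Inv N) := by
  suffices key : ∀ m i s, i + m = N → Inv i s →
      Runs (.loop e p) s ((m + 1) * (e.cost + 1 + T)) (Inv N) from key N 0 s (zero_add N) h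
  intro m
  induction m with
  | zero =>
    rintro i s rfl hi
    exact ⟨_, s, .loop_done (halt s hi), by simp, hi⟩
  | succ m ih =>
    intro i s him hi
    obtain ⟨hne, t, s', he, ht, hi'⟩ := step i s (by omega) hi
    obtain ⟨t', s'', he', ht', hN⟩ := ih (i + 1) s' (by omega) hi'
    refine ⟨_, s'', .loop_step hne he he', ?_, hN⟩
    rw [add_mul (m + 1) 1, one_mul]
    omega

/-! ### Quantities that are computable in polynomial time -/

/-- An instance of WED. -/
structure Inst where
  n : ℕ
  G : SimpleGraph (Fin n)
  w : Fin n → ℕ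

/-- The store `s` contains the instance `I` in the input arrays, and, for every variable `i`, the
vertex `e i` in the register `l i`. -/
structure Represents {ι : Type} (I : Inst) (l : ι → ℕ) (e : ι → Fin I.n) (s : Store) : Prop where
  size : s.reg 0 = I.n
  input : ∀ a < 2, s.arr a = (inputStore I.G I.w).arr a
  var : ∀ i, s.reg (l i) = e i

/-- The number `f I e`, which depends on an instance `I` and on vertices `e i` of it, is computable
in polynomial time. The program may be asked to find the vertices `e i` in arbitrary registers
among `0, …, c`; it has to leave these registers alone and to put the result into the register
`c + 1`. Quantifying over `c` is what makes programs composable: intermediate results are kept in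
registers that later parts do not touch. -/
def Computes {ι : Type} (f : ∀ I : Inst, (ι → Fin I.n) → ℕ) : Prop :=
  ∀ (l : ι → ℕ) (c : ℕ), (∀ i, l i ≤ c) → ∃ (p : Prog) (q : Polynomial ℕ),
    ∀ I e s, Represents I l e s → Runs p s (q.eval I.n) fun s' =>
      s'.arr = s.arr ∧ (∀ r ≤ c, s'.reg r = s.reg r) ∧ s'.reg (c + 1) = f I e

theorem Represents.congr {ι : Type} {I : Inst} {l : ι → ℕ} {e : ι → Fin I.n} {s s' : Store} {c : ℕ}
    (h : Represents I l e s) (hl : ∀ i, l i ≤ c) (harr : ∀ a < 2, s'.arr a = s.arr a)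
    (hreg : ∀ r ≤ c, s'.reg r = s.reg r) : Represents I l e s' where
  size := by rw [hreg 0 (Nat.zero_le c), h.size]
  input a ha := by rw [harr a ha, h.input a ha]
  var i := by rw [hreg _ (hl i), h.var i]

namespace Computes

variable {ι κ : Type}

theorem congr {f g : ∀ I : Inst, (ι → Fin I.n) → ℕ} (hf : Computes f)
    (h : ∀ I e, f I e = g I e) : Computes g := by
  have : f = g := funext₂ h
  exact this ▸ hf

theorem reindex {f : ∀ I : Inst, (ι → Fin I.n) → ℕ} (hf : Computes f) (σ : ι → κ) :
    Computes fun I (e : κ → Fin I.n) => f I fun i => e (σ i) := by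
  intro l c hl
  obtain ⟨p, q, h⟩ := hf (l ∘ σ) c fun i => hl (σ i)
  exact ⟨p, q, fun I e s hs => h I _ s ⟨hs.size, hs.input, fun i => hs.var (σ i)⟩⟩

theorem expr {f : ∀ I : Inst, (ι → Fin I.n) → ℕ}
    (h : ∀ l : ι → ℕ, ∃ E : Expr, ∀ I e s, Represents I l e s → E.eval s = f I e) :
    Computes f := by
  intro l c hl
  obtain ⟨E, hE⟩ := h l
  refine ⟨.assign (c + 1) E, Polynomial.C (E.cost + 1), fun I e s hs => ?_⟩
  rw [Polynomial.eval_C]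
  exact .assign fun s' ha hx hr =>
    ⟨ha, fun r hrc => hr r (by omega), hx.trans (hE I e s hs)⟩

theorem const (m : ℕ) : Computes (ι := ι) fun _ _ => m :=
  .expr fun _ => ⟨.const m, fun _ _ _ _ => rfl⟩

theorem var (i : ι) : Computes (ι := ι) fun _ e => e i :=
  .expr fun l => ⟨.reg (l i), fun _ _ _ hs => hs.var i⟩

theorem binop {f g : ∀ I : Inst, (ι → Fin I.n) → ℕ} (hf : Computes f) (hg : Computes g)
    {op : ℕ → ℕ → ℕ} (E : Expr → Expr → Expr)
    (hE : ∀ s a b, (E a b).eval s = op (a.eval s) (b.eval s)) :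
    Computes fun I e => op (f I e) (g I e) := by
  intro l c hl
  obtain ⟨p, q, hp⟩ := hf l c hl
  obtain ⟨p', q', hp'⟩ := hg l (c + 1) fun i => (hl i).trans (by omega)
  refine ⟨p.seq (p'.seq (.assign (c + 1) (E (.reg (c + 1)) (.reg (c + 2))))),
    q + (q' + Polynomial.C ((E (.reg (c + 1)) (.reg (c + 2))).cost + 1)), fun I e s hs => ?_⟩
  rw [Polynomial.eval_add, Polynomial.eval_add, Polynomial.eval_C]
  refine (hp I e s hs).seq fun s₁ ⟨ha₁, hr₁, hf₁⟩ => ?_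
  have hs₁ := hs.congr (s' := s₁) hl (fun a _ => by rw [ha₁]) hr₁
  refine (hp' I e s₁ hs₁).seq fun s₂ ⟨ha₂, hr₂, hg₂⟩ =>
    .assign fun s₃ ha₃ hx₃ hr₃ => ⟨?_, fun r hr => ?_, ?_⟩
  · rw [ha₃, ha₂, ha₁]
  · rw [hr₃ r (by omega), hr₂ r (by omega), hr₁ r hr]
  · have h1 : s₂.reg (c + 1) = f I e := by rw [hr₂ _ le_rfl, hf₁]
    simp [hx₃, hE, Expr.eval, h1, hg₂]

theorem add {f g : ∀ I : Inst, (ι → Fin I.n) → ℕ} (hf : Computes f) (hg : Computes g) :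
    Computes fun I e => f I e + g I e :=
  binop hf hg .add fun _ _ _ => rfl

theorem sub {f g : ∀ I : Inst, (ι → Fin I.n) → ℕ} (hf : Computes f) (hg : Computes g) :
    Computes fun I e => f I e - g I e :=
  binop hf hg .sub fun _ _ _ => rfl

/-- Access to the input arrays. -/
theorem input {f : ∀ I : Inst, (ι → Fin I.n) → ℕ} (hf : Computes f) {a : ℕ} (ha : a < 2) :
    Computes fun I e => (inputStore I.G I.w).arr a (f I e) := by
  intro l c hl
  obtain ⟨p, q, hp⟩ := hf l c hl
  refine ⟨p.seq (.assign (c + 1) (.cell a (.reg (c + 1)))), q + 3, fun I e s hs => ?_⟩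
  rw [Polynomial.eval_add, Polynomial.eval_ofNat]
  refine (hp I e s hs).seq fun s₁ ⟨ha₁, hr₁, hf₁⟩ =>
    .assign fun s₂ ha₂ hx₂ hr₂ => ⟨ha₂.trans ha₁, fun r hr => ?_, ?_⟩
  · rw [hr₂ r (by omega), hr₁ r hr]
  · simp [hx₂, Expr.eval, hf₁, ha₁, hs.input a ha]

theorem ite_ne_zero {f g h : ∀ I : Inst, (ι → Fin I.n) → ℕ} (hf : Computes f) (hg : Computes g)
    (hh : Computes h) : Computes fun I e => if f I e ≠ 0 then g I e else h I e := by
  intro l c hl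
  obtain ⟨p, q, hp⟩ := hf l c hl
  obtain ⟨p₁, q₁, hp₁⟩ := hg l c hl
  obtain ⟨p₂, q₂, hp₂⟩ := hh l c hl
  refine ⟨p.seq (.cond (.reg (c + 1)) p₁ p₂), q + (2 + (q₁ + q₂)), fun I e s hs => ?_⟩
  rw [Polynomial.eval_add, Polynomial.eval_add, Polynomial.eval_add, Polynomial.eval_ofNat]
  refine (hp I e s hs).seq fun s₁ ⟨ha₁, hr₁, hf₁⟩ => ?_
  have hs₁ := hs.congr (s' := s₁) hl (fun a _ => by rw [ha₁]) hr₁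
  refine .cond (fun hne => ?_) fun hz => ?_
  · refine (hp₁ I e s₁ hs₁).mono le_rfl fun s₂ ⟨ha₂, hr₂, h₂⟩ => ⟨by rw [ha₂, ha₁], ?_, ?_⟩
    · exact fun r hr => by rw [hr₂ r hr, hr₁ r hr]
    · exact h₂.trans (if_pos (by simpa [Expr.eval, hf₁] using hne)).symm
  · refine (hp₂ I e s₁ hs₁).mono le_rfl fun s₂ ⟨ha₂, hr₂, h₂⟩ => ⟨by rw [ha₂, ha₁], ?_, ?_⟩
    · exact fun r hr => by rw [hr₂ r hr, hr₁ r hr]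
    · exact h₂.trans (if_neg (by simpa [Expr.eval, hf₁] using hz)).symm

/-- Summation over all vertices. In the context `Option ι` the variable `none` is the summation
variable. -/
theorem sum {f : ∀ I : Inst, (ι → Fin I.n) → Fin I.n → ℕ}
    (hf : Computes fun I (e : Option ι → Fin I.n) => f I (fun i => e (some i)) (e none)) :
    Computes fun I e => ∑ x, f I e x := by
  intro l c hl
  -- The sum is accumulated in register `c + 1`, and register `c + 2` is the summation variable.
  obtain ⟨p, q, hp⟩ := hf (fun i => i.elim (c + 2) l) (c + 2) (by
    rintro (_ | i)
    · exact le_rfl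
    · exact (hl i).trans (by omega))
  refine ⟨.seq (.assign (c + 1) (.const 0)) (.seq (.assign (c + 2) (.const 0))
    (.loop (.sub (.reg 0) (.reg (c + 2)))
      (p.seq (.seq (.assign (c + 1) (.add (.reg (c + 1)) (.reg (c + 3))))
        (.assign (c + 2) (.add (.reg (c + 2)) (.const 1))))))),
    2 + (2 + (Polynomial.X + 1) * (4 + (q + (4 + 4)))), fun I e s hs => ?_⟩
  simp only [Polynomial.eval_add, Polynomial.eval_mul, Polynomial.eval_X, Polynomial.eval_one,
    Polynomial.eval_ofNat]
  refine Runs.seq (Q := fun s₁ => s₁.arr = s.arr ∧ (∀ r ≤ c, s₁.reg r = s.reg r) ∧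
      s₁.reg (c + 1) = 0)
    (.assign fun s₁ ha hx hr => ⟨ha, fun r hrc => hr r (by omega), hx⟩)
    fun s₁ ⟨ha₁, hr₁, hz₁⟩ => ?_
  let Inv : ℕ → Store → Prop := fun i s' => s'.arr = s.arr ∧ (∀ r ≤ c, s'.reg r = s.reg r) ∧
    s'.reg (c + 1) = ∑ x with (x : Fin I.n).val < i, f I e x ∧ s'.reg (c + 2) = i
  refine Runs.seq (Q := Inv 0) (.assign fun s₂ ha₂ hx₂ hr₂ =>
      ⟨ha₂.trans ha₁, fun r hr => ?_, ?_, hx₂⟩) fun s₂ h₂ =>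
    (Runs.loop Inv ?_ ?_ h₂).mono le_rfl fun s₃ h₃ => ⟨h₃.1, h₃.2.1, ?_⟩
  · rw [hr₂ r (by omega), hr₁ r hr]
  · simp [hr₂ (c + 1) (by omega), hz₁]
  · rintro i s' hi ⟨ha, hr, hsum, hx⟩
    have h0 : s'.reg 0 = I.n := by rw [hr 0 (Nat.zero_le c), hs.size]
    refine ⟨by simp only [Expr.eval, h0, hx]; omega, ?_⟩
    have hs' : Represents I (fun i => i.elim (c + 2) l)
        (fun j : Option ι => j.elim ⟨i, hi⟩ e) s' := by
      refine ⟨h0, fun a ha' => by rw [ha, hs.input a ha'], ?_⟩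
      rintro (_ | j)
      · exact hx
      · exact (hr _ (hl j)).trans (hs.var j)
    refine (hp I _ s' hs').seq fun s₄ ⟨ha₄, hr₄, hf₄⟩ => ?_
    refine Runs.seq (Q := fun s₅ => s₅.arr = s.arr ∧ (∀ r ≤ c, s₅.reg r = s.reg r) ∧
      s₅.reg (c + 1) = ∑ x with (x : Fin I.n).val < i + 1, f I e x ∧ s₅.reg (c + 2) = i)
      (.assign fun s₅ ha₅ hx₅ hr₅ => ⟨?_, fun r hrc => ?_, ?_, ?_⟩)
      fun s₅ ⟨ha₅, hr₅, hsum₅, hx₅⟩ => .assign fun s₆ ha₆ hx₆ hr₆ =>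
        ⟨ha₆.trans ha₅, fun r hrc => ?_, ?_, ?_⟩
    · rw [ha₅, ha₄, ha]
    · rw [hr₅ r (by omega), hr₄ r (by omega), hr r hrc]
    · have hset : Finset.univ.filter (fun x : Fin I.n => (x : ℕ) < i + 1) =
          insert ⟨i, hi⟩ (Finset.univ.filter fun x : Fin I.n => (x : ℕ) < i) := by
        ext x
        simp only [Finset.mem_filter, Finset.mem_univ, true_and, Finset.mem_insert, Fin.ext_iff]
        omega
      rw [hset, Finset.sum_insert (by simp), hx₅]
      simp only [Expr.eval]
      rw [hf₄, hr₄ (c + 1) (by omega), hsum, add_comm]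
      rfl
    · rw [hr₅ _ (by omega), hr₄ _ le_rfl, hx]
    · rw [hr₆ r (by omega), hr₅ r hrc]
    · rw [hr₆ _ (by omega), hsum₅]
    · simp [hx₆, Expr.eval, hx₅]
  · rintro s' ⟨-, hr, -, hx⟩
    simp only [Expr.eval, hx, hr 0 (Nat.zero_le c), hs.size, Nat.sub_self]
  · rw [h₃.2.2.1]
    simp

theorem sum_finset {α : Type} (A : Finset α) {f : α → ∀ I : Inst, (ι → Fin I.n) → ℕ}
    (hf : ∀ a, Computes (f a)) : Computes fun I e => ∑ a ∈ A, f a I e := by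
  classical
  induction A using Finset.induction_on with
  | empty => simpa using const 0
  | insert a A ha ih => exact (add (hf a) ih).congr fun I e => by rw [Finset.sum_insert ha]

theorem mul_size {f : ∀ I : Inst, (ι → Fin I.n) → ℕ} (hf : Computes f) :
    Computes fun I e => f I e * I.n :=
  (sum (f := fun I e _ => f I e) (hf.reindex some)).congr fun I e => by simp [mul_comm]

theorem weight (i : ι) : Computes fun I e => I.w (e i) :=
  (input (var i) one_lt_two).congr fun I e => by simp [inputStore]

end Computes

/-! ### Properties that are decidable in polynomial time -/

open Classical in
/-- The property `P I e` of an instance `I` and vertices `e i` of it is decidable in polynomial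
time. -/
def Decides {ι : Type} (P : ∀ I : Inst, (ι → Fin I.n) → Prop) : Prop :=
  Computes fun I e => if P I e then 1 else 0

open Classical in
theorem Computes.ite {ι : Type} {P : ∀ I : Inst, (ι → Fin I.n) → Prop}
    {f g : ∀ I : Inst, (ι → Fin I.n) → ℕ} (hP : Decides P) (hf : Computes f) (hg : Computes g) :
    Computes fun I e => if P I e then f I e else g I e :=
  (ite_ne_zero hP hf hg).congr fun I e => by simp

namespace Decides

variable {ι κ : Type} {P Q : ∀ I : Inst, (ι → Fin I.n) → Prop}
  {f g : ∀ I : Inst, (ι → Fin I.n) → ℕ}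

theorem congr (hP : Decides P) (h : ∀ I e, P I e ↔ Q I e) : Decides Q := by
  have : P = Q := funext₂ fun I e => propext (h I e)
  exact this ▸ hP

theorem reindex (hP : Decides P) (σ : ι → κ) :
    Decides fun I (e : κ → Fin I.n) => P I fun i => e (σ i) :=
  Computes.reindex hP σ

theorem ne_zero (hf : Computes f) : Decides fun I e => f I e ≠ 0 := by
  classical
  exact (Computes.ite_ne_zero hf (.const 1) (.const 0)).congr fun I e => by congr

theorem lt (hf : Computes f) (hg : Computes g) : Decides fun I e => f I e < g I e :=
  (ne_zero (hg.sub hf)).congr fun I e => by omega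

theorem const (p : Prop) : Decides (ι := ι) fun _ _ => p :=
  Computes.const _

theorem ite {R : ∀ I : Inst, (ι → Fin I.n) → Prop} (hP : Decides P) (hQ : Decides Q)
    (hR : Decides R) : Decides fun I e => (P I e ∧ Q I e) ∨ (¬ P I e ∧ R I e) := by
  classical
  exact (Computes.ite hP hQ hR).congr fun I e => by by_cases h : P I e <;> simp [h]

theorem not (hP : Decides P) : Decides fun I e => ¬ P I e :=
  (ite hP (const False) (const True)).congr fun I e => by simp

theorem and (hP : Decides P) (hQ : Decides Q) : Decides fun I e => P I e ∧ Q I e :=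
  (ite hP hQ (const False)).congr fun I e => by simp

theorem or (hP : Decides P) (hQ : Decides Q) : Decides fun I e => P I e ∨ Q I e :=
  (ite hP (const True) hQ).congr fun I e => by tauto

theorem imp (hP : Decides P) (hQ : Decides Q) : Decides fun I e => P I e → Q I e :=
  (ite hP hQ (const True)).congr fun I e => by tauto

theorem iff (hP : Decides P) (hQ : Decides Q) : Decides fun I e => (P I e ↔ Q I e) :=
  (ite hP hQ hQ.not).congr fun I e => by tauto

theorem eq (hf : Computes f) (hg : Computes g) : Decides fun I e => f I e = g I e :=
  ((lt hf hg).not.and (lt hg hf).not).congr fun I e => by omega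

theorem exists_vertex {P : ∀ I : Inst, (ι → Fin I.n) → Fin I.n → Prop}
    (hP : Decides fun I (e : Option ι → Fin I.n) => P I (fun i => e (some i)) (e none)) :
    Decides fun I e => ∃ x, P I e x := by
  classical
  exact (ne_zero (Computes.sum (f := fun I e x => if P I e x then 1 else 0) hP)).congr
    fun I e => by simp

theorem forall_vertex {P : ∀ I : Inst, (ι → Fin I.n) → Fin I.n → Prop}
    (hP : Decides fun I (e : Option ι → Fin I.n) => P I (fun i => e (some i)) (e none)) :
    Decides fun I e => ∀ x, P I e x :=
  (exists_vertex (P := fun I e x => ¬ P I e x) hP.not).not.congr fun I e => by simp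

theorem exists_fintype {α : Type} [Fintype α] {P : α → ∀ I : Inst, (ι → Fin I.n) → Prop}
    (hP : ∀ a, Decides (P a)) : Decides fun I e => ∃ a, P a I e := by
  classical
  exact (ne_zero (Computes.sum_finset Finset.univ hP)).congr fun I e => by simp

theorem forall_fintype {α : Type} [Fintype α] {P : α → ∀ I : Inst, (ι → Fin I.n) → Prop}
    (hP : ∀ a, Decides (P a)) : Decides fun I e => ∀ a, P a I e :=
  (exists_fintype fun a => (hP a).not).not.congr fun I e => by simp

theorem exists_tuple {m : ℕ} {P : ∀ I : Inst, (ι → Fin I.n) → (Fin m → Fin I.n) → Prop}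
    (hP : Decides fun I (e : ι ⊕ Fin m → Fin I.n) =>
      P I (fun i => e (.inl i)) fun j => e (.inr j)) :
    Decides fun I e => ∃ S, P I e S := by
  induction m generalizing ι with
  | zero =>
    refine (hP.reindex (Sum.elim id Fin.elim0)).congr fun _ _ => ?_
    rw [Unique.exists_iff]
    exact iff_of_eq (congrArg _ (Subsingleton.elim _ _))
  | succ m ih =>
    refine Decides.congr (exists_vertex (P := fun I e x => ∃ S, P I e (Fin.cons x S)) ?_)
      fun I e => ⟨fun ⟨x, S, h⟩ => ⟨_, h⟩,
        fun ⟨S, h⟩ => ⟨S 0, Fin.tail S, by rwa [Fin.cons_self_tail]⟩⟩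
    refine ih (P := fun I (e : Option ι → Fin I.n) S =>
      P I (fun i => e (some i)) (Fin.cons (e none) S)) ?_
    refine (hP.reindex (Sum.elim (fun i => .inl (some i))
      (Fin.cons (.inl none) fun j => .inr j))).congr fun _ _ => iff_of_eq ?_
    refine congrArg _ (funext fun j => ?_)
    refine Fin.cases ?_ (fun j => ?_) j <;> rfl

theorem forall_tuple {m : ℕ} {P : ∀ I : Inst, (ι → Fin I.n) → (Fin m → Fin I.n) → Prop}
    (hP : Decides fun I (e : ι ⊕ Fin m → Fin I.n) =>
      P I (fun i => e (.inl i)) fun j => e (.inr j)) :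
    Decides fun I e => ∀ S, P I e S :=
  (exists_tuple (P := fun I e S => ¬ P I e S) hP.not).not.congr fun I e => by simp

theorem eq_vertex (i j : ι) : Decides (ι := ι) fun _ e => e i = e j :=
  (eq (.var i) (.var j)).congr fun _ _ => Fin.ext_iff.symm

theorem lt_vertex (i j : ι) : Decides (ι := ι) fun _ e => e i < e j :=
  lt (.var i) (.var j)

theorem adj (i j : ι) : Decides fun I e => I.G.Adj (e i) (e j) := by
  refine (ne_zero (Computes.input ((Computes.var i).mul_size.add (.var j)) two_pos)).congr
    fun I e => ?_
  simp only [inputStore, if_true, ne_eq, ite_eq_right_iff, one_ne_zero, imp_false, not_not]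
  refine ⟨fun ⟨u, v, huv, h⟩ => ?_, fun h => ⟨_, _, h, rfl⟩⟩
  -- The cell index determines the row and the column by division with remainder.
  have hn : 0 < I.n := (Nat.zero_le _).trans_lt u.2
  have h1 := congrArg (· / I.n) h
  have h2 := congrArg (· % I.n) h
  simp only [Nat.mul_comm _ I.n, Nat.mul_add_div hn, Nat.mul_add_mod,
    Nat.div_eq_of_lt (Fin.is_lt _), Nat.mod_eq_of_lt (Fin.is_lt _), add_zero] at h1 h2
  rwa [Fin.ext h1, Fin.ext h2]

/-- A property of a quantified vertex, given by the variable `none`, remains decidable when this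
vertex is replaced by any variable of another context. -/
theorem subst {P : ∀ I : Inst, (ι → Fin I.n) → Fin I.n → Prop}
    (hP : Decides fun I (e : Option ι → Fin I.n) => P I (fun i => e (some i)) (e none))
    (σ : ι → κ) (j : κ) : Decides fun I (e : κ → Fin I.n) => P I (fun i => e (σ i)) (e j) :=
  hP.reindex fun i => i.elim j σ

/-- Being an efficient dominating set is decidable for a vertex set with a decidable membership
relation. -/
theorem isEffDom {P : ∀ I : Inst, (ι → Fin I.n) → Fin I.n → Prop}
    (hP : Decides fun I (e : Option ι → Fin I.n) => P I (fun i => e (some i)) (e none)) :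
    Decides fun I e => ∀ v, ∃! d, P I e d ∧ (d = v ∨ I.G.Adj d v) := by
  refine forall_vertex (P := fun I e v => ∃! d, P I e d ∧ (d = v ∨ I.G.Adj d v)) ?_
  refine exists_vertex (P := fun I (e : Option ι → Fin I.n) d =>
    (P I (fun i => e (some i)) d ∧ (d = e none ∨ I.G.Adj d (e none))) ∧
      ∀ d', P I (fun i => e (some i)) d' ∧ (d' = e none ∨ I.G.Adj d' (e none)) → d' = d) ?_
  have key {κ : Type} (σ : ι → κ) (d v : κ) : Decides fun I (e : κ → Fin I.n) =>
      P I (fun i => e (σ i)) (e d) ∧ (e d = e v ∨ I.G.Adj (e d) (e v)) :=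
    (hP.subst σ d).and ((eq_vertex d v).or (adj d v))
  refine (key (fun i => some (some i)) none (some none)).and (forall_vertex
    (P := fun I (e : Option (Option ι) → Fin I.n) d' => P I (fun i => e (some (some i))) d' ∧
      (d' = e (some none) ∨ I.G.Adj d' (e (some none))) → d' = e none) ?_)
  exact (key (fun i => some (some (some i))) none (some (some none))).imp
    (eq_vertex none (some none))

end Decides

open Classical in
/-- If a vertex set with a decidable membership relation is an efficient dominating set of minimum
weight whenever there is any efficient dominating set, then WED is solvable in polynomial time:
whether there is one can be found out by testing the candidate. -/
theorem solvableInPolyTime_of_decides {C : ∀ n : ℕ, SimpleGraph (Fin n) → Prop}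
    {Out : ∀ I : Inst, Fin I.n → Prop} (hOut : Decides fun I (e : Unit → Fin I.n) => Out I (e ()))
    (hC : ∀ I : Inst, C I.n I.G → ∀ D, IsEffDom I.G D →
      IsMinEffDom I.G I.w (Finset.univ.filter (Out I))) : SolvableInPolyTime C := by
  -- Register `1` holds the result of the test, register `2` runs through the vertices.
  have hED : Decides (ι := Empty) fun I _ => ∀ v, ∃! d, Out I d ∧ (d = v ∨ I.G.Adj d v) :=
    Decides.isEffDom (P := fun I _ => Out I) (hOut.reindex fun _ => none)
  obtain ⟨p, q, hp⟩ := hED (fun _ => 0) 0 fun _ => le_rfl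
  obtain ⟨p', q', hp'⟩ := hOut (fun _ => 2) 2 fun _ => le_rfl
  refine ⟨.seq p (.seq (.assign 2 (.const 0)) (.seq (.loop (.sub (.reg 0) (.reg 2))
    (.seq p' (.seq (.write 2 (.reg 2) (.reg 3)) (.assign 2 (.add (.reg 2) (.const 1))))))
    (.assign 0 (.reg 1)))), q + (2 + ((Polynomial.X + 1) * (4 + (q' + (3 + 4))) + 2)),
    fun n G w hG => ?_⟩
  let I : Inst := ⟨n, G, w⟩
  suffices h : Runs _ (inputStore G w) _ (IsAnswer G w) by
    obtain ⟨t, s, he, ht, hs⟩ := h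
    exact ⟨t, s, he, ht, hs⟩
  simp only [Polynomial.eval_add, Polynomial.eval_mul, Polynomial.eval_X, Polynomial.eval_one,
    Polynomial.eval_ofNat]
  let Inv : ℕ → Store → Prop := fun i s =>
    s.reg 0 = n ∧ (∀ a < 2, s.arr a = (inputStore G w).arr a) ∧
    (s.reg 1 ≠ 0 ↔ ∀ v, ∃! d, Out I d ∧ (d = v ∨ G.Adj d v)) ∧
    s.reg 2 = i ∧ ∀ v : Fin n, v < i → s.arr 2 v = if Out I v then 1 else 0
  refine (hp I (fun i => i.elim) (inputStore G w) ⟨rfl, fun _ _ => rfl, fun i => i.elim⟩).seq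
    fun s₁ ⟨ha₁, hr₁, h₁⟩ => ?_
  refine Runs.seq (Q := Inv 0) (.assign fun s₂ ha₂ hx₂ hr₂ => ⟨?_, ?_, ?_, hx₂, ?_⟩)
    fun s₂ h₂ => Runs.seq (Runs.loop (N := n) Inv ?_ ?_ h₂) fun s₃ ⟨_, _, he, _, hout⟩ =>
    .assign fun s₄ ha₄ hx₄ _ => ?_
  · rw [hr₂ 0 (by omega), hr₁ 0 le_rfl]
    rfl
  · intro a _
    rw [ha₂, ha₁]
  · rw [hr₂ 1 (by omega), h₁]
    simp [I]
  · intro v hv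
    exact absurd hv (Nat.not_lt_zero _)
  · rintro i s hi ⟨h0, ha, he, hx, hout⟩
    refine ⟨by simp only [Expr.eval, h0, hx]; omega, ?_⟩
    refine (hp' I (fun _ => ⟨i, hi⟩) s ⟨h0, ha, fun _ => hx⟩).seq fun s₁ ⟨ha₁, hr₁, h₁⟩ => ?_
    refine Runs.seq (Q := fun s' => s'.reg = s₁.reg ∧
        s'.arr 2 = Function.update (s₁.arr 2) (s₁.reg 2) (s₁.reg 3) ∧
        ∀ b ≠ 2, s'.arr b = s₁.arr b)
      (.write fun s' hr h2 hb => ⟨hr, h2, hb⟩) fun s₂ ⟨hr₂, h2₂, hb₂⟩ =>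
      .assign fun s₃ ha₃ hx₃ hr₃ => ⟨?_, fun a ha' => ?_, ?_, ?_, fun v hv => ?_⟩
    · rw [hr₃ 0 (by omega), hr₂, hr₁ 0 (by omega), h0]
    · rw [ha₃, hb₂ a (by omega), ha₁, ha a ha']
    · rw [hr₃ 1 (by omega), hr₂, hr₁ 1 (by omega), he]
    · simp only [hx₃, Expr.eval, hr₂, hr₁ 2 le_rfl, hx]
    · rw [ha₃, h2₂, hr₁ 2 le_rfl, hx]
      rcases Nat.lt_succ_iff_lt_or_eq.1 hv with hv | hv
      · rw [Function.update_of_ne hv.ne, ha₁, hout v hv]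
      · rw [hv, Function.update_self, h₁, show v = ⟨i, hi⟩ from Fin.ext hv]
  · rintro s ⟨h0, -, -, hx, -⟩
    simp [Expr.eval, h0, hx]
  · have hset : outputSet n s₄ = Finset.univ.filter (Out I) := by
      ext v
      simp [outputSet, ha₄, hout v v.2]
    have hiff : (∀ v, ∃! d, Out I d ∧ (d = v ∨ G.Adj d v)) ↔
        IsEffDom G (Finset.univ.filter (Out I)) := by
      simp [IsEffDom, I]
    have hx : s₄.reg 0 = s₃.reg 1 := hx₄
    rw [IsAnswer, hset, hx]
    by_cases h : IsEffDom G (Finset.univ.filter (Out I))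
    · exact .inl ⟨he.2 (hiff.2 h), hC I hG _ h⟩
    · exact .inr ⟨not_not.1 (he.not.2 (hiff.not.2 h)), fun ⟨D, hD⟩ => h (hC I hG D hD).1⟩

/-! ### Efficient dominating sets and distances -/

section Near

variable {V : Type} (G : SimpleGraph V)

/-- `u` is at distance at most one from `v`. -/
def Near1 (v u : V) : Prop := v = u ∨ G.Adj v u

/-- `u` is at distance at most two from `v`. -/
def Near2 (v u : V) : Prop := ∃ x, Near1 G v x ∧ Near1 G x u

/-- `u` is at distance at most three from `v`. -/
def Near3 (v u : V) : Prop := ∃ x, Near2 G v x ∧ Near1 G x u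

variable {G} {u v x : V}

theorem Near1.symm (h : Near1 G v u) : Near1 G u v :=
  h.imp Eq.symm fun h => h.symm

theorem Near2.symm (h : Near2 G v u) : Near2 G u v :=
  h.imp fun _ hx => ⟨hx.2.symm, hx.1.symm⟩

theorem Near1.near2 (h : Near1 G v u) : Near2 G v u :=
  ⟨u, h, .inl rfl⟩

theorem Near2.near3 (h : Near2 G v u) : Near3 G v u :=
  ⟨u, h, .inl rfl⟩

theorem Near3.refl (v : V) : Near3 G v v :=
  Near2.near3 (Near1.near2 (.inl rfl))

theorem Near3.symm (h : Near3 G v u) : Near3 G u v := by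
  obtain ⟨y, ⟨x, hvx, hxy⟩, hyu⟩ := h
  exact ⟨x, ⟨y, hyu.symm, hxy.symm⟩, hvx.symm⟩

/-- The definition of efficient domination in terms of `Near1`. -/
theorem isEffDom_iff {D : Finset V} : IsEffDom G D ↔ ∀ v, ∃! d, d ∈ D ∧ Near1 G d v :=
  Iff.rfl

variable {D : Finset V}

theorem IsEffDom.eq_of_near1 (hD : IsEffDom G D) (hu : u ∈ D) (hv : v ∈ D) (hux : Near1 G u x)
    (hvx : Near1 G v x) : u = v :=
  (hD x).unique ⟨hu, hux⟩ ⟨hv, hvx⟩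

theorem IsEffDom.eq_of_near2 (hD : IsEffDom G D) (hu : u ∈ D) (hv : v ∈ D) (h : Near2 G u v) :
    u = v :=
  let ⟨_, hux, hxv⟩ := h
  hD.eq_of_near1 hu hv hux hxv.symm

end Near

/-! ### Graphs with an induced path on five vertices -/

section Candidates

variable {V : Type} (G : SimpleGraph V) {m : ℕ}

/-- Membership of `u` in the set that consists of the vertices `S i` and of all vertices at distance
at least three from them. When the latter are pairwise nonadjacent, this is the only possible
efficient dominating set that contains the `S i`. -/
def Extension (S : Fin m → V) (u : V) : Prop := (∃ i, S i = u) ∨ ∀ i, ¬ Near2 G (S i) u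

variable {G}

/-- Adding an edge that is anticomplete to an induced `P_5 + jP_2` gives an induced
`P_5 + (j+1)P_2`. -/
theorem isIndContained_succ {j : ℕ} (f : P5kP2 j ↪g G) {x y : V} (hxy : G.Adj x y)
    (hx : ∀ a, ¬ Near1 G x (f a)) (hy : ∀ a, ¬ Near1 G y (f a)) :
    (P5kP2 (j + 1)).IsIndContained G := by
  have hf : ∀ a b, G.Adj (f a) (f b) ↔ (P5kP2 j).Adj a b := fun _ _ => f.map_adj_iff
  have hfi : Function.Injective f := f.injective
  generalize (f : Fin 5 ⊕ Fin j × Fin 2 → V) = f at hf hfi hx hy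
  have hx1 : ∀ a, x ≠ f a := fun a h => hx a (.inl h)
  have hx2 : ∀ a, ¬ G.Adj x (f a) := fun a h => hx a (.inr h)
  have hy1 : ∀ a, y ≠ f a := fun a h => hy a (.inl h)
  have hy2 : ∀ a, ¬ G.Adj y (f a) := fun a h => hy a (.inr h)
  have hx1' : ∀ a, f a ≠ x := fun a => (hx1 a).symm
  have hy1' : ∀ a, f a ≠ y := fun a => (hy1 a).symm
  have hx2' : ∀ a, ¬ G.Adj (f a) x := fun a h => hx2 a h.symm
  have hy2' : ∀ a, ¬ G.Adj (f a) y := fun a h => hy2 a h.symm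
  let F : Fin 5 ⊕ Fin (j + 1) × Fin 2 → V := Sum.elim (fun i => f (.inl i)) fun p =>
    Fin.lastCases (motive := fun _ => V) (![x, y] p.2) (fun i => f (.inr (i, p.2))) p.1
  have hadj : ∀ a b, G.Adj (F a) (F b) ↔ (P5kP2 (j + 1)).Adj a b := by
    rintro (a | ⟨a, c⟩) (b | ⟨b, d⟩)
    · simp [F, hf, P5kP2]
    · refine Fin.lastCases ?_ (fun b => ?_) b
      · fin_cases d <;> simp [F, P5kP2, hx2', hy2']
      · simp [F, hf, P5kP2]
    · refine Fin.lastCases ?_ (fun a => ?_) a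
      · fin_cases c <;> simp [F, P5kP2, hx2, hy2]
      · simp [F, hf, P5kP2]
    · refine Fin.lastCases ?_ (fun a => ?_) a <;> refine Fin.lastCases ?_ (fun b => ?_) b
      · fin_cases c <;> fin_cases d <;>
          simp [F, P5kP2, copies, SimpleGraph.pathGraph_adj, hxy, hxy.symm]
      · fin_cases c <;> simp [F, P5kP2, copies, hx2, hy2, (Fin.castSucc_ne_last _).symm]
      · fin_cases d <;> simp [F, P5kP2, copies, hx2', hy2', Fin.castSucc_ne_last]
      · simp [F, hf, P5kP2, copies]
  have hinj : Function.Injective F := by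
    rintro (a | ⟨a, c⟩) (b | ⟨b, d⟩)
    · simp [F, hfi.eq_iff]
    · refine Fin.lastCases ?_ (fun b => ?_) b
      · fin_cases d <;> simp [F, hx1', hy1']
      · simp [F, hfi.eq_iff]
    · refine Fin.lastCases ?_ (fun a => ?_) a
      · fin_cases c <;> simp [F, hx1, hy1]
      · simp [F, hfi.eq_iff]
    · refine Fin.lastCases ?_ (fun a => ?_) a <;> refine Fin.lastCases ?_ (fun b => ?_) b
      · fin_cases c <;> fin_cases d <;> simp [F, hxy.ne, hxy.ne.symm]
      · fin_cases c <;> simp [F, hx1, hy1]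
      · fin_cases d <;> simp [F, hx1', hy1']
      · simp [F, hfi.eq_iff]
  exact ⟨⟨⟨F, hinj⟩, hadj _ _⟩⟩

/-- If `G` contains `P_5 + jP_2` but not `P_5 + (j+1)P_2`, then the vertices of an efficient
dominating set that dominate a copy of `P_5 + jP_2` determine all others. -/
theorem exists_extension {j k : ℕ} (hj : j < k) (f : P5kP2 j ↪g G)
    (hfree : IndFree (P5kP2 (j + 1)) G) {D : Finset V} (hD : IsEffDom G D) :
    ∃ S : Fin (5 + 2 * k) → V, ∀ u, u ∈ D ↔ Extension G S u := by
  choose d hd using fun v => (hD v).exists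
  obtain ⟨g, hg⟩ : ∃ g : Fin (5 + 2 * k) → Fin 5 ⊕ Fin j × Fin 2, Function.Surjective g := by
    obtain ⟨g⟩ : Nonempty (Fin 5 ⊕ Fin j × Fin 2 ↪ Fin (5 + 2 * k)) :=
      Function.Embedding.nonempty_of_card_le (by simp; omega)
    exact ⟨_, Function.invFun_surjective g.injective⟩
  refine ⟨fun i => d (f (g i)), fun u => ⟨fun hu => ?_, ?_⟩⟩
  · refine or_iff_not_imp_left.2 fun h i hi => h ⟨i, hD.eq_of_near2 (hd _).1 hu hi⟩
  · rintro (⟨i, rfl⟩ | h)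
    · exact (hd _).1
    have hfar : ∀ a, ¬ Near2 G (d (f a)) u := fun a => by
      obtain ⟨i, rfl⟩ := hg a
      exact h i
    obtain ⟨hdu, hu | hu⟩ := hd u
    · exact hu ▸ hdu
    -- An undominated neighbour would give an edge that is anticomplete to the copy of `P_5 + jP_2`.
    refine absurd (isIndContained_succ f hu (fun a ha => ?_) fun a ha => ?_) hfree
    · exact hfar a (Near1.near2 (hD.eq_of_near1 (hd _).1 hdu (hd (f a)).2 ha ▸ .inr hu))
    · exact hfar a ⟨_, (hd (f a)).2, ha.symm⟩

/-- In a `(P_5 + kP_2)`-free graph with an induced `P_5`, every efficient dominating set is the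
extension of few of its vertices: those dominating a maximal induced `P_5 + jP_2`. -/
theorem exists_extension_of_indFree {k : ℕ}
    (h5 : (SimpleGraph.pathGraph 5).IsIndContained G) (hfree : IndFree (P5kP2 k) G)
    {D : Finset V} (hD : IsEffDom G D) :
    ∃ S : Fin (5 + 2 * k) → V, ∀ u, u ∈ D ↔ Extension G S u := by
  have h0 : (P5kP2 0).IsIndContained G := by
    obtain ⟨f⟩ := h5
    refine ⟨⟨⟨Sum.elim f fun p => p.1.elim0, ?_⟩, ?_⟩⟩
    · rintro (a | ⟨a, -⟩) (b | ⟨b, -⟩)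
      · simp
      · exact b.elim0
      · exact a.elim0
      · exact b.elim0
    · rintro (a | ⟨a, -⟩) (b | ⟨b, -⟩)
      · exact f.map_adj_iff
      · exact b.elim0
      · exact a.elim0
      · exact b.elim0
  obtain ⟨j, hj, hfj, hfj'⟩ : ∃ j < k, (P5kP2 j).IsIndContained G ∧ IndFree (P5kP2 (j + 1)) G := by
    by_contra! H
    have : ∀ j ≤ k, (P5kP2 j).IsIndContained G := by
      intro j
      induction j with
      | zero => exact fun _ => h0
      | succ j ih => exact fun hj => not_not.1 (H j hj (ih (by omega)))
    exact hfree (this k le_rfl)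
  obtain ⟨f⟩ := hfj
  exact exists_extension hj f hfj' hD

variable (G) (w : V → ℕ) [Fintype V]

/-- The extension of `S` is an efficient dominating set. -/
def ExtensionValid (S : Fin m → V) : Prop := ∀ v, ∃! d, Extension G S d ∧ Near1 G d v

open Classical in
/-- The total weight of the extension of `S`. -/
noncomputable def extensionCost (S : Fin m → V) : ℕ := ∑ u, if Extension G S u then w u else 0

variable [LinearOrder V]

/-- The extension of `S` is an efficient dominating set, and it is the cheapest one of this form;
ties are broken by the lexicographic order of the tuples. -/
def BestTuple (S : Fin m → V) : Prop :=
  ExtensionValid G S ∧ ∀ S' : Fin m → V, ExtensionValid G S' →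
    extensionCost G w S < extensionCost G w S' ∨
      (extensionCost G w S = extensionCost G w S' ∧ toLex S ≤ toLex S')

/-- Membership of `u` in the extension of the best `m`-tuple. -/
def BestExtension (m : ℕ) (u : V) : Prop := ∃ S : Fin m → V, BestTuple G w S ∧ Extension G S u

variable {G w}

theorem BestTuple.eq {S S' : Fin m → V} (hS : BestTuple G w S) (hS' : BestTuple G w S') :
    S = S' := by
  obtain h1 | ⟨h1, h1'⟩ := hS.2 S' hS'.1 <;> obtain h2 | ⟨h2, h2'⟩ := hS'.2 S hS.1
  · omega
  · omega
  · omega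
  · exact toLex.injective (le_antisymm h1' h2')

open Classical in
/-- If every efficient dominating set is the extension of an `m`-tuple, then the extension of the
best `m`-tuple is an efficient dominating set of minimum weight, provided there is any. -/
theorem isMinEffDom_bestExtension
    (h : ∀ D, IsEffDom G D → ∃ S : Fin m → V, ∀ u, u ∈ D ↔ Extension G S u) {D : Finset V}
    (hD : IsEffDom G D) : IsMinEffDom G w (Finset.univ.filter (BestExtension G w m)) := by
  have hvalid : ∀ D, IsEffDom G D → ∃ S : Fin m → V, ExtensionValid G S ∧
      extensionCost G w S = ∑ u ∈ D, w u := by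
    intro D hD
    obtain ⟨S, hS⟩ := h D hD
    refine ⟨S, fun v => by simpa only [← hS] using isEffDom_iff.1 hD v, ?_⟩
    simp only [extensionCost, ← hS, Finset.sum_ite_mem, Finset.univ_inter]
  obtain ⟨S₀, hS₀, -⟩ := hvalid D hD
  obtain ⟨S, hS, hmin⟩ := Finset.exists_min_image
    (Finset.univ.filter fun S : Fin m → V => ExtensionValid G S)
    (fun S => toLex (extensionCost G w S, toLex S)) ⟨S₀, by simpa using hS₀⟩
  simp only [Finset.mem_filter, Finset.mem_univ, true_and] at hS hmin
  have hbest : BestTuple G w S := ⟨hS, fun S' hS' => by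
    simpa only [Prod.Lex.toLex_le_toLex] using hmin S' hS'⟩
  have hmem : ∀ u, BestExtension G w m u ↔ Extension G S u := fun u =>
    ⟨fun ⟨S', hS', hu⟩ => hS'.eq hbest ▸ hu, fun hu => ⟨S, hbest, hu⟩⟩
  refine ⟨isEffDom_iff.2 fun v => by simpa [hmem] using hS v, fun D' hD' => ?_⟩
  obtain ⟨S', hS', hcost⟩ := hvalid D' hD'
  have hcost' : ∑ u ∈ Finset.univ.filter (BestExtension G w m), w u = extensionCost G w S := by
    simp only [hmem, extensionCost, Finset.sum_filter]
  have := hbest.2 S' hS'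
  omega

end Candidates

/-! ### Graphs without an induced path on five vertices -/

section PathFree

variable {V : Type} {G : SimpleGraph V}

/-- The distinctness of the five vertices need not be assumed: it follows from the adjacencies. -/
theorem false_of_pathFree (h5 : ¬ (SimpleGraph.pathGraph 5).IsIndContained G) {a b c d e : V}
    (hab : G.Adj a b) (hbc : G.Adj b c) (hcd : G.Adj c d) (hde : G.Adj d e) (hac : ¬ G.Adj a c)
    (had : ¬ G.Adj a d) (hae : ¬ G.Adj a e) (hbd : ¬ G.Adj b d) (hbe : ¬ G.Adj b e)
    (hce : ¬ G.Adj c e) : False := by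
  let S : Fin 5 → V := ![a, b, c, d, e]
  have hS : ∀ i j, G.Adj (S i) (S j) ↔ (SimpleGraph.pathGraph 5).Adj i j := by
    intro i j
    rw [SimpleGraph.pathGraph_adj]
    fin_cases i <;> fin_cases j <;>
      simp [S, hab, hbc, hcd, hde, hac, had, hae, hbd, hbe, hce, G.adj_comm b a, G.adj_comm c a,
        G.adj_comm c b, G.adj_comm d a, G.adj_comm d b, G.adj_comm d c, G.adj_comm e a,
        G.adj_comm e b, G.adj_comm e c, G.adj_comm e d]
  -- Distinct vertices of the path have distinct neighbourhoods.
  have htwin : ∀ i j : Fin 5, (∀ l, (SimpleGraph.pathGraph 5).Adj i l ↔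
      (SimpleGraph.pathGraph 5).Adj j l) → i = j := by
    simp only [SimpleGraph.pathGraph_adj]
    decide
  exact h5 ⟨⟨⟨S, fun i j hij => htwin i j fun l => by rw [← hS, ← hS, hij]⟩, hS _ _⟩⟩

/-- A connected graph without an induced `P_5` has diameter at most three. -/
theorem Near3.trans_near1 (h5 : ¬ (SimpleGraph.pathGraph 5).IsIndContained G) {v u x : V}
    (hvu : Near3 G v u) (hux : Near1 G u x) : Near3 G v x := by
  by_contra h
  obtain ⟨b, ⟨a, hva, hab⟩, hbu⟩ := hvu
  have key : ∀ p q, Near1 G v p → Near1 G p q → ¬ Near1 G q x :=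
    fun p q hp hq hx => h ⟨q, ⟨p, hp, hq⟩, hx⟩
  have r : ∀ p, Near1 G p p := fun p => .inl rfl
  have hva' : G.Adj v a := hva.resolve_left fun e => key b u (e ▸ hab) hbu hux
  have hab' : G.Adj a b := hab.resolve_left fun e => key a u hva (e ▸ hbu) hux
  have hbu' : G.Adj b u := hbu.resolve_left fun e => key a b hva hab (e ▸ hux)
  have hux' : G.Adj u x := hux.resolve_left fun e => key a b hva hab (e ▸ hbu)
  exact false_of_pathFree h5 hva' hab' hbu' hux' (fun e => key b u (.inr e) hbu hux)
    (fun e => key u u (.inr e) (r u) hux) (fun e => key x x (.inr e) (r x) (r x))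
    (fun e => key a u hva (.inr e) hux) (fun e => key a x hva (.inr e) (r x))
    (fun e => key a b hva hab (.inr e))

theorem Near3.trans (h5 : ¬ (SimpleGraph.pathGraph 5).IsIndContained G) {v u x : V}
    (hvu : Near3 G v u) (hux : Near3 G u x) : Near3 G v x := by
  obtain ⟨b, ⟨a, hua, hab⟩, hbx⟩ := hux
  exact ((hvu.trans_near1 h5 hua).trans_near1 h5 hab).trans_near1 h5 hbx

variable (G) in
/-- `u` is at distance exactly three from `v`. -/
def Remote (v u : V) : Prop := Near3 G v u ∧ ¬ Near2 G v u

/-- A vertex at distance two from `v` is adjacent to all or to none of the vertices of a connected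
component of the graph induced by the vertices remote from `v`. -/
theorem Remote.adj_of_adj (h5 : ¬ (SimpleGraph.pathGraph 5).IsIndContained G) {v y q q' : V}
    (hq : Remote G v q) (hq' : Remote G v q') (hqq' : G.Adj q q') (hvy : Near2 G v y)
    (hyq : G.Adj y q) : G.Adj y q' := by
  by_contra h
  have hy : ¬ Near1 G v y := fun h => hq.2 ⟨y, h, .inr hyq⟩
  obtain ⟨a, hva, hay⟩ := hvy
  have hva' : G.Adj v a := hva.resolve_left fun e => hy (e ▸ hay)
  have hay' : G.Adj a y := hay.resolve_left fun e => hy (e ▸ hva)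
  exact false_of_pathFree h5 hva' hay' hyq hqq' (fun e => hy (.inr e))
    (fun e => hq.2 (Near1.near2 (.inr e))) (fun e => hq'.2 (Near1.near2 (.inr e)))
    (fun e => hq.2 ⟨a, hva, .inr e⟩) (fun e => hq'.2 ⟨a, hva, .inr e⟩) h

variable (G) in
/-- `u` is remote from `v`, and it is adjacent to all other vertices of its connected component in
the graph induced by the vertices remote from `v`. The component is not mentioned: `u` is adjacent
to all of it as soon as it is adjacent to all its vertices at distance two. -/
def Universal (v u : V) : Prop :=
  Remote G v u ∧ ∀ x y, Remote G v x → Remote G v y → G.Adj u x → G.Adj x y → Near1 G u y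

theorem Universal.near1_of_adj (h5 : ¬ (SimpleGraph.pathGraph 5).IsIndContained G) {v g h z : V}
    (hg : Universal G v g) (hh : Universal G v h) (hgh : G.Adj g h) (hz : Near1 G g z) :
    Near1 G h z := by
  obtain rfl | hgz := hz
  · exact .inr hgh.symm
  by_cases hzr : Near2 G v z
  · exact .inr (hg.1.adj_of_adj h5 hh.1 hgh hzr hgz.symm).symm
  · exact hh.2 g z hg.1 ⟨hg.1.1.trans_near1 h5 (.inr hgz), hzr⟩ hgh.symm hgz

/-! In the following lemmas, `d` assigns to each vertex the vertex of `D` that dominates it. -/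

section Dominator

variable {D : Finset V} {d : V → V} {v : V}

theorem IsEffDom.remote_dominator (h5 : ¬ (SimpleGraph.pathGraph 5).IsIndContained G)
    (hD : IsEffDom G D) (hd : ∀ z, d z ∈ D ∧ Near1 G (d z) z) (hv : v ∈ D) {q : V}
    (hq : Remote G v q) : Remote G v (d q) := by
  refine ⟨hq.1.trans_near1 h5 (hd q).2.symm, fun h => hq.2 (Near1.near2 ?_)⟩
  rw [hD.eq_of_near2 hv (hd q).1 h]
  exact (hd q).2

theorem IsEffDom.dominator_eq_of_mem (hD : IsEffDom G D) (hd : ∀ z, d z ∈ D ∧ Near1 G (d z) z)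
    {u z : V} (hu : u ∈ D) (h : Near1 G u z) : d z = u :=
  hD.eq_of_near1 (hd z).1 hu (hd z).2 h

theorem IsEffDom.dominator_eq_of_near2 (h5 : ¬ (SimpleGraph.pathGraph 5).IsIndContained G)
    (hD : IsEffDom G D) (hd : ∀ z, d z ∈ D ∧ Near1 G (d z) z) (hv : v ∈ D) {y q : V}
    (hq : Remote G v q) (hy : Near2 G v y) (hyq : G.Adj y q) : d y = d q := by
  refine hD.dominator_eq_of_mem hd (hd q).1 ?_
  obtain h | h := (hd q).2
  · rw [h]
    exact .inr hyq.symm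
  · exact .inr (hq.adj_of_adj h5 (hD.remote_dominator h5 hd hv hq) h.symm hy hyq).symm

/-- The vertices of a connected component of the graph induced by the vertices remote from a vertex
of `D` are all dominated by the same vertex, because they have a common neighbour outside. -/
theorem IsEffDom.dominator_eq_of_adj (h5 : ¬ (SimpleGraph.pathGraph 5).IsIndContained G)
    (hD : IsEffDom G D) (hd : ∀ z, d z ∈ D ∧ Near1 G (d z) z) (hv : v ∈ D) {q q' : V}
    (hq : Remote G v q) (hq' : Remote G v q') (h : G.Adj q q') : d q = d q' := by
  obtain ⟨y, hy, hyq⟩ := hq.1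
  have hyq' : G.Adj y q := hyq.resolve_left fun e => hq.2 (e ▸ hy)
  rw [← hD.dominator_eq_of_near2 h5 hd hv hq hy hyq',
    ← hD.dominator_eq_of_near2 h5 hd hv hq' hy (hq.adj_of_adj h5 hq' h hy hyq')]

theorem IsEffDom.universal_of_mem (h5 : ¬ (SimpleGraph.pathGraph 5).IsIndContained G)
    (hD : IsEffDom G D) (hd : ∀ z, d z ∈ D ∧ Near1 G (d z) z) (hv : v ∈ D) {u : V} (hu : u ∈ D)
    (hvu : Remote G v u) : Universal G v u := by
  refine ⟨hvu, fun x y hx hy hux hxy => ?_⟩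
  rw [← hD.dominator_eq_of_mem hd hu (.inl rfl), hD.dominator_eq_of_adj h5 hd hv hvu hx hux,
    hD.dominator_eq_of_adj h5 hd hv hx hy hxy]
  exact (hd y).2

/-- A universal vertex dominates the same vertices as its dominator, and may thus replace it. -/
theorem IsEffDom.near1_iff_of_universal (h5 : ¬ (SimpleGraph.pathGraph 5).IsIndContained G)
    (hD : IsEffDom G D) (hd : ∀ z, d z ∈ D ∧ Near1 G (d z) z) (hv : v ∈ D) {g : V}
    (hg : Universal G v g) (z : V) : Near1 G g z ↔ Near1 G (d g) z := by
  obtain h | h := (hd g).2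
  · rw [h]
  · have hdg := hD.universal_of_mem h5 hd hv (hd g).1 (hD.remote_dominator h5 hd hv hg.1)
    exact ⟨hg.near1_of_adj h5 hdg h.symm, hdg.near1_of_adj h5 hg h⟩

end Dominator

variable [LinearOrder V] (G) (w : V → ℕ)

/-- The vertex `v` together with, from each connected component of the graph induced by the
vertices remote from `v`, the universal vertex of least weight; ties are broken by the order of the
vertices. -/
def Pick (v u : V) : Prop :=
  v = u ∨ (Universal G v u ∧
    ∀ x, Universal G v x → G.Adj u x → w u < w x ∨ (w u = w x ∧ u < x))

/-- The set `Pick v` is an efficient dominating set of the connected component of `v`. -/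
def PickValid (v : V) : Prop := ∀ z, Near3 G v z → ∃! u, Pick G w v u ∧ Near1 G u z

open Classical in
/-- The total weight of `Pick v`. -/
noncomputable def pickCost [Fintype V] (v : V) : ℕ := ∑ u, if Pick G w v u then w u else 0

/-- `v` is the vertex of its connected component for which `Pick v` is the cheapest efficient
dominating set of the component; ties are broken by the order of the vertices. -/
def Selected [Fintype V] (v : V) : Prop :=
  PickValid G w v ∧ ∀ v', Near3 G v v' → PickValid G w v' →
    pickCost G w v < pickCost G w v' ∨ (pickCost G w v = pickCost G w v' ∧ v ≤ v')

/-- Membership of `u` in the union of the sets `Pick v`, for the selected vertices `v`. -/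
def SelectedUnion [Fintype V] (u : V) : Prop := ∃ v, Selected G w v ∧ Pick G w v u

variable {G w} {D : Finset V} {d : V → V} {v : V}

theorem Pick.near3 {u : V} (h : Pick G w v u) : Near3 G v u := by
  obtain rfl | h := h
  · exact .refl v
  · exact h.1.1.1

theorem IsEffDom.near1_iff_of_pick (h5 : ¬ (SimpleGraph.pathGraph 5).IsIndContained G)
    (hD : IsEffDom G D) (hd : ∀ z, d z ∈ D ∧ Near1 G (d z) z) (hv : v ∈ D) {g : V}
    (hg : Pick G w v g) (z : V) : Near1 G g z ↔ Near1 G (d g) z := by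
  obtain rfl | hg := hg
  · rw [hD.dominator_eq_of_mem hd hv (.inl rfl)]
  · exact hD.near1_iff_of_universal h5 hd hv hg.1 z

theorem IsEffDom.weight_le_of_pick (h5 : ¬ (SimpleGraph.pathGraph 5).IsIndContained G)
    (hD : IsEffDom G D) (hd : ∀ z, d z ∈ D ∧ Near1 G (d z) z) (hv : v ∈ D) {g : V}
    (hg : Pick G w v g) : w g ≤ w (d g) := by
  obtain rfl | ⟨hg, hmin⟩ := hg
  · rw [hD.dominator_eq_of_mem hd hv (.inl rfl)]
  obtain h | h := (hd g).2
  · rw [h]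
  · have hdg := hD.universal_of_mem h5 hd hv (hd g).1 (hD.remote_dominator h5 hd hv hg.1)
    have := hmin _ hdg h.symm
    omega

theorem IsEffDom.pick_injective (h5 : ¬ (SimpleGraph.pathGraph 5).IsIndContained G)
    (hD : IsEffDom G D) (hd : ∀ z, d z ∈ D ∧ Near1 G (d z) z) (hv : v ∈ D) {g g' : V}
    (hg : Pick G w v g) (hg' : Pick G w v g') (h : d g = d g') : g = g' := by
  have hgg' : Near1 G g g' := (hD.near1_iff_of_pick h5 hd hv hg g').2 (h ▸ (hd g').2)
  have hfar : ∀ x, Universal G v x → ¬ Near1 G v x := fun x hx h => hx.1.2 h.near2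
  obtain rfl | hadj := hgg'
  · rfl
  obtain rfl | ⟨hg, hmin⟩ := hg
  · obtain rfl | ⟨hg', -⟩ := hg'
    · rfl
    · exact absurd (.inr hadj) (hfar _ hg')
  · obtain rfl | ⟨hg', hmin'⟩ := hg'
    · exact absurd (.inr hadj.symm) (hfar _ hg)
    · obtain h1 | ⟨h1, h1'⟩ := hmin _ hg' hadj <;> obtain h2 | ⟨h2, h2'⟩ := hmin' _ hg hadj.symm
      · omega
      · omega
      · omega
      · exact absurd h1' h2'.asymm

variable [Fintype V]

theorem IsEffDom.exists_pick (h5 : ¬ (SimpleGraph.pathGraph 5).IsIndContained G)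
    (hD : IsEffDom G D) (hd : ∀ z, d z ∈ D ∧ Near1 G (d z) z) (hv : v ∈ D) {u : V} (hu : u ∈ D)
    (hvu : Near3 G v u) : ∃ g, Pick G w v g ∧ d g = u := by
  classical
  by_cases huv : Near2 G v u
  · exact ⟨v, .inl rfl, by
      rw [hD.dominator_eq_of_mem hd hv (.inl rfl), hD.eq_of_near2 hv hu huv]⟩
  have hur := hD.universal_of_mem h5 hd hv hu ⟨hvu, huv⟩
  obtain ⟨g, hg, hmin⟩ := Finset.exists_min_image
    (Finset.univ.filter fun g => Universal G v g ∧ d g = u) (fun g => toLex (w g, g))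
    ⟨u, by simp [hur, hD.dominator_eq_of_mem hd hu (.inl rfl)]⟩
  simp only [Finset.mem_filter, Finset.mem_univ, true_and] at hg hmin
  refine ⟨g, .inr ⟨hg.1, fun x hx hgx => ?_⟩, hg.2⟩
  have := hmin x ⟨hx, by rw [← hg.2, hD.dominator_eq_of_adj h5 hd hv hg.1.1 hx.1 hgx]⟩
  rw [Prod.Lex.toLex_le_toLex] at this
  exact this.imp_right fun h => ⟨h.1, h.2.lt_of_ne hgx.ne⟩

theorem IsEffDom.pickValid (h5 : ¬ (SimpleGraph.pathGraph 5).IsIndContained G)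
    (hD : IsEffDom G D) (hv : v ∈ D) : PickValid G w v := by
  choose d hd using fun z => (hD z).exists
  intro z hz
  obtain ⟨g, hg, hgz⟩ := hD.exists_pick (w := w) h5 hd hv (hd z).1
    (hz.trans_near1 h5 (Near1.symm (hd z).2))
  refine ⟨g, ⟨hg, (hD.near1_iff_of_pick h5 hd hv hg z).2 (hgz ▸ (hd z).2)⟩,
    fun g' ⟨hg', hgz'⟩ => hD.pick_injective h5 hd hv hg' hg ?_⟩
  rw [hgz]
  exact hD.eq_of_near1 (hd g').1 (hd z).1 ((hD.near1_iff_of_pick h5 hd hv hg' z).1 hgz') (hd z).2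

open Classical in
theorem IsEffDom.pickCost_le (h5 : ¬ (SimpleGraph.pathGraph 5).IsIndContained G)
    (hD : IsEffDom G D) (hv : v ∈ D) : pickCost G w v ≤ ∑ u ∈ D with Near3 G v u, w u := by
  choose d hd using fun z => (hD z).exists
  rw [pickCost, ← Finset.sum_filter]
  refine (Finset.sum_le_sum (g := fun u => w (d u)) fun u hu => ?_).trans ?_
  · exact hD.weight_le_of_pick h5 hd hv (Finset.mem_filter.1 hu).2
  rw [← Finset.sum_image (g := d) (f := w) fun a ha b hb h => hD.pick_injective (w := w) h5 hd hv
    (Finset.mem_filter.1 ha).2 (Finset.mem_filter.1 hb).2 h]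
  refine Finset.sum_le_sum_of_subset fun u hu => ?_
  obtain ⟨g, hg, rfl⟩ := Finset.mem_image.1 hu
  exact Finset.mem_filter.2 ⟨(hd g).1,
    (Finset.mem_filter.1 hg).2.near3.trans_near1 h5 (Near1.symm (hd g).2)⟩

theorem Selected.eq {v' : V} (hv : Selected G w v) (hv' : Selected G w v')
    (h : Near3 G v v') : v = v' := by
  obtain h1 | ⟨h1, h1'⟩ := hv.2 v' h hv'.1 <;> obtain h2 | ⟨h2, h2'⟩ := hv'.2 v h.symm hv.1
  · omega
  · omega
  · omega
  · exact le_antisymm h1' h2'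

theorem IsEffDom.exists_selected (h5 : ¬ (SimpleGraph.pathGraph 5).IsIndContained G)
    (hD : IsEffDom G D) (z : V) : ∃ v, Selected G w v ∧ Near3 G v z := by
  classical
  obtain ⟨u, hu, huz⟩ := (hD z).exists
  obtain ⟨v, hv, hmin⟩ := Finset.exists_min_image
    (Finset.univ.filter fun v => Near3 G z v ∧ PickValid G w v)
    (fun v => toLex (pickCost G w v, v))
    ⟨u, by simpa using ⟨(Near2.near3 (Near1.near2 huz)).symm, hD.pickValid h5 hu⟩⟩
  simp only [Finset.mem_filter, Finset.mem_univ, true_and] at hv hmin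
  refine ⟨v, ⟨hv.2, fun v' hvv' hv' => ?_⟩, hv.1.symm⟩
  have := hmin v' ⟨hv.1.trans h5 hvv', hv'⟩
  rwa [Prod.Lex.toLex_le_toLex] at this

open Classical in
/-- In a graph without an induced `P_5` that has an efficient dominating set, the union of the
cheapest candidates of the connected components is an efficient dominating set of minimum weight. -/
theorem isMinEffDom_selectedUnion (h5 : ¬ (SimpleGraph.pathGraph 5).IsIndContained G)
    (hD : IsEffDom G D) :
    IsMinEffDom G w (Finset.univ.filter (SelectedUnion G w)) := by
  refine ⟨fun z => ?_, fun D' hD' => ?_⟩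
  · obtain ⟨v, hv, hvz⟩ := hD.exists_selected (w := w) h5 z
    obtain ⟨u, ⟨hu, huz⟩, huniq⟩ := hv.1 z hvz
    refine ⟨u, ⟨by simpa using ⟨v, hv, hu⟩, huz⟩, fun u' ⟨hu', huz'⟩ => ?_⟩
    obtain ⟨v', hv', hvu'⟩ := (Finset.mem_filter.1 hu').2
    have hvv' : v' = v := hv'.eq hv ((hvu'.near3.trans_near1 h5 huz').trans h5 hvz.symm)
    exact huniq u' ⟨hvv' ▸ hvu', huz'⟩
  · have hle : ∀ v, Selected G w v → pickCost G w v ≤ ∑ u ∈ D' with Near3 G v u, w u := by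
      intro v hv
      obtain ⟨v', hv', hvv'⟩ := (hD' v).exists
      have hvv'' : Near3 G v v' := (Near2.near3 (Near1.near2 hvv')).symm
      have h1 : pickCost G w v ≤ pickCost G w v' := by
        have := hv.2 v' hvv'' (hD'.pickValid h5 hv')
        omega
      refine (h1.trans (hD'.pickCost_le h5 hv')).trans (Finset.sum_le_sum_of_subset fun u hu => ?_)
      rw [Finset.mem_filter] at hu ⊢
      exact ⟨hu.1, hvv''.trans h5 hu.2⟩
    have hunion : Finset.univ.filter (SelectedUnion G w) =
        (Finset.univ.filter (Selected G w)).biUnion fun v => Finset.univ.filter (Pick G w v) := by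
      ext u
      simp [SelectedUnion]
    have hdisj : ∀ v ∈ Finset.univ.filter (Selected G w), ∀ v' ∈ Finset.univ.filter (Selected G w),
        ∀ u, Near3 G v u → Near3 G v' u → v = v' := fun v hv v' hv' u hu hu' =>
      (Finset.mem_filter.1 hv).2.eq (Finset.mem_filter.1 hv').2 (hu.trans h5 hu'.symm)
    rw [hunion, Finset.sum_biUnion]
    · refine (Finset.sum_le_sum (g := fun v => ∑ u ∈ D' with Near3 G v u, w u)
        fun v hv => ?_).trans ?_
      · rw [Finset.sum_filter]
        exact hle v (Finset.mem_filter.1 hv).2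
      · rw [← Finset.sum_biUnion]
        · refine Finset.sum_le_sum_of_subset fun u hu => ?_
          obtain ⟨v, -, hu⟩ := Finset.mem_biUnion.1 hu
          exact (Finset.mem_filter.1 hu).1
        · intro v hv v' hv' hne
          refine Finset.disjoint_left.2 fun u hu hu' => hne (hdisj v hv v' hv' u ?_ ?_)
          · exact (Finset.mem_filter.1 hu).2
          · exact (Finset.mem_filter.1 hu').2
    · intro v hv v' hv' hne
      refine Finset.disjoint_left.2 fun u hu hu' => hne (hdisj v hv v' hv' u ?_ ?_)
      · exact (Finset.mem_filter.1 hu).2.near3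
      · exact (Finset.mem_filter.1 hu').2.near3

end PathFree

/-! ### Deciding membership in the candidates -/

namespace Decides

variable {ι : Type}

theorem near1 (i j : ι) : Decides fun I e => Near1 I.G (e i) (e j) :=
  (eq_vertex i j).or (adj i j)

theorem near2 (i j : ι) : Decides fun I e => Near2 I.G (e i) (e j) :=
  exists_vertex (P := fun I e x => Near1 I.G (e i) x ∧ Near1 I.G x (e j))
    ((near1 (some i) none).and (near1 none (some j)))

theorem near3 (i j : ι) : Decides fun I e => Near3 I.G (e i) (e j) :=
  exists_vertex (P := fun I e x => Near2 I.G (e i) x ∧ Near1 I.G x (e j))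
    ((near2 (some i) none).and (near1 none (some j)))

theorem remote (i j : ι) : Decides fun I e => Remote I.G (e i) (e j) :=
  (near3 i j).and (near2 i j).not

theorem universal (i j : ι) : Decides fun I e => Universal I.G (e i) (e j) :=
  (remote i j).and <| forall_vertex (P := fun I e x => ∀ y, Remote I.G (e i) x →
    Remote I.G (e i) y → I.G.Adj (e j) x → I.G.Adj x y → Near1 I.G (e j) y) <|
  forall_vertex (P := fun I e y => Remote I.G (e (some i)) (e none) →
    Remote I.G (e (some i)) y → I.G.Adj (e (some j)) (e none) → I.G.Adj (e none) y →
      Near1 I.G (e (some j)) y) <|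
  (remote (some (some i)) (some none)).imp <| (remote (some (some i)) none).imp <|
    (adj (some (some j)) (some none)).imp <| (adj (some none) none).imp <|
      near1 (some (some j)) none

/-- Comparison with ties broken by a second criterion. -/
theorem lex {Q : ∀ I : Inst, (ι → Fin I.n) → Prop} {f g : ∀ I : Inst, (ι → Fin I.n) → ℕ}
    (hf : Computes f) (hg : Computes g) (hQ : Decides Q) :
    Decides fun I e => f I e < g I e ∨ (f I e = g I e ∧ Q I e) :=
  (lt hf hg).or ((eq hf hg).and hQ)

theorem pick (i j : ι) : Decides fun I e => Pick I.G I.w (e i) (e j) :=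
  (eq_vertex i j).or <| (universal i j).and <| forall_vertex (P := fun I e x =>
    Universal I.G (e i) x → I.G.Adj (e j) x → I.w (e j) < I.w x ∨ (I.w (e j) = I.w x ∧ e j < x)) <|
  (universal (some i) none).imp <| (adj (some j) none).imp <|
    lex (.weight (some j)) (.weight none) (lt_vertex (some j) none)

theorem pickValid (i : ι) : Decides fun I e => PickValid I.G I.w (e i) := by
  refine forall_vertex (P := fun I e z => Near3 I.G (e i) z →
    ∃! u, Pick I.G I.w (e i) u ∧ Near1 I.G u z) <| (near3 (some i) none).imp ?_
  refine exists_vertex (P := fun I (e : Option ι → Fin I.n) u =>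
    (Pick I.G I.w (e (some i)) u ∧ Near1 I.G u (e none)) ∧
      ∀ u', Pick I.G I.w (e (some i)) u' ∧ Near1 I.G u' (e none) → u' = u) <|
    ((pick (some (some i)) none).and (near1 none (some none))).and ?_
  exact forall_vertex (P := fun I (e : Option (Option ι) → Fin I.n) u' =>
    Pick I.G I.w (e (some (some i))) u' ∧ Near1 I.G u' (e (some none)) → u' = e none) <|
    ((pick (some (some (some i))) none).and (near1 none (some (some none)))).imp
      (eq_vertex none (some none))

theorem _root_.WED.Computes.pickCost (i : ι) :
    Computes fun I e => pickCost I.G I.w (e i) := by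
  classical
  exact Computes.sum (f := fun I e u => if Pick I.G I.w (e i) u then I.w u else 0)
    (.ite (pick (some i) none) (.weight none) (.const 0))

theorem selected (i : ι) : Decides fun I e => Selected I.G I.w (e i) :=
  (pickValid i).and <| forall_vertex (P := fun I e v' => Near3 I.G (e i) v' →
    PickValid I.G I.w v' → pickCost I.G I.w (e i) < pickCost I.G I.w v' ∨
      (pickCost I.G I.w (e i) = pickCost I.G I.w v' ∧ e i ≤ v')) <|
  (near3 (some i) none).imp <| (pickValid none).imp <|
    lex (.pickCost (some i)) (.pickCost none)
      ((lt_vertex none (some i)).not.congr fun _ _ => not_lt)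

theorem selectedUnion (i : ι) : Decides fun I e => SelectedUnion I.G I.w (e i) :=
  exists_vertex (P := fun I e v => Selected I.G I.w v ∧ Pick I.G I.w v (e i))
    ((selected none).and (pick none (some i)))

theorem extension {m : ℕ} (S : Fin m → ι) (i : ι) :
    Decides fun I e => Extension I.G (fun j => e (S j)) (e i) :=
  (exists_fintype fun j => eq_vertex (S j) i).or (forall_fintype fun j => (near2 (S j) i).not)

theorem extensionValid {m : ℕ} (S : Fin m → ι) :
    Decides fun I e => ExtensionValid I.G (fun j => e (S j)) :=
  isEffDom (P := fun I e d => Extension I.G (fun j => e (S j)) d)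
    (extension (fun j => some (S j)) none)

theorem _root_.WED.Computes.extensionCost {m : ℕ} (S : Fin m → ι) :
    Computes fun I e => extensionCost I.G I.w fun j => e (S j) := by
  classical
  exact Computes.sum (f := fun I e u => if Extension I.G (fun j => e (S j)) u then I.w u else 0)
    (.ite (extension (fun j => some (S j)) none) (.weight none) (.const 0))

theorem toLex_le {m : ℕ} (S T : Fin m → ι) :
    Decides (ι := ι) fun _ e => toLex (fun j => e (S j)) ≤ toLex fun j => e (T j) := by
  refine Decides.congr (Decides.not (P := fun _ e =>
    ∃ i : Fin m, (∀ j : Fin m, j < i → e (T j) = e (S j)) ∧ e (T i) < e (S i)) ?_)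
    fun _ _ => not_lt (α := Lex (Fin m → Fin _))
  exact exists_fintype fun i => (forall_fintype fun j =>
    (const (j < i)).imp (eq_vertex (T j) (S j))).and (lt_vertex (T i) (S i))

theorem bestTuple {m : ℕ} (S : Fin m → ι) :
    Decides fun I e => BestTuple I.G I.w fun j => e (S j) :=
  (extensionValid S).and <| forall_tuple (P := fun I e S' => ExtensionValid I.G S' →
    extensionCost I.G I.w (fun j => e (S j)) < extensionCost I.G I.w S' ∨
      (extensionCost I.G I.w (fun j => e (S j)) = extensionCost I.G I.w S' ∧
        toLex (fun j => e (S j)) ≤ toLex S')) <|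
  (extensionValid Sum.inr).imp <|
    lex (.extensionCost fun j => Sum.inl (S j)) (.extensionCost Sum.inr)
      (toLex_le (fun j => Sum.inl (S j)) Sum.inr)

theorem bestExtension (m : ℕ) (i : ι) : Decides fun I e => BestExtension I.G I.w m (e i) :=
  exists_tuple (P := fun I e S => BestTuple I.G I.w S ∧ Extension I.G S (e i))
    ((bestTuple Sum.inr).and (extension Sum.inr (Sum.inl i)))

theorem pathGraph_isIndContained (m : ℕ) : Decides (ι := ι) fun I _ =>
    (SimpleGraph.pathGraph m).IsIndContained I.G := by
  refine Decides.congr (exists_tuple (m := m) (P := fun I _ S => (∀ i j, S i = S j → i = j) ∧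
    ∀ i j, I.G.Adj (S i) (S j) ↔ (SimpleGraph.pathGraph m).Adj i j) ?_) fun _ _ => ?_
  · exact (forall_fintype fun i => forall_fintype fun j => (eq_vertex (Sum.inr i) (Sum.inr j)).imp
      (const _)).and (forall_fintype fun i => forall_fintype fun j =>
        (adj (Sum.inr i) (Sum.inr j)).iff (const _))
  · exact ⟨fun ⟨S, hS, hadj⟩ => ⟨⟨⟨S, hS⟩, hadj _ _⟩⟩,
      fun ⟨f⟩ => ⟨f, fun _ _ h => f.injective h, fun _ _ => f.map_adj_iff⟩⟩

end Decides

end WED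

theorem mainTheorem1 (k : ℕ) :
    WED.SolvableInPolyTime (fun _ G => WED.IndFree (WED.P5kP2 k) G) := by
  refine WED.solvableInPolyTime_of_decides (Out := fun I u =>
      ((SimpleGraph.pathGraph 5).IsIndContained I.G ∧ WED.BestExtension I.G I.w (5 + 2 * k) u) ∨
        (¬ (SimpleGraph.pathGraph 5).IsIndContained I.G ∧ WED.SelectedUnion I.G I.w u))
    ((WED.Decides.pathGraph_isIndContained 5).ite (WED.Decides.bestExtension (5 + 2 * k) ())
      (WED.Decides.selectedUnion ())) fun I hfree D hD => ?_
  by_cases h5 : (SimpleGraph.pathGraph 5).IsIndContained I.G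
  · convert WED.isMinEffDom_bestExtension (w := I.w)
      (fun D hD => WED.exists_extension_of_indFree h5 hfree hD) hD using 3 with u
    simp [h5]
  · convert WED.isMinEffDom_selectedUnion (w := I.w) h5 hD using 3 with u
    simp [h5]
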